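/- Let $\mathcal X$ be a measurable space and let $\mathcal Y$ be a countable (for example finite) set with its discrete topology and $\sigma$-algebra. A generalized decision rule is a bilinear form $\beta$ on pairs $(f,\varphi)$, where $f\in C_b(\mathcal Y)$ and $\varphi$ is a bounded signed measure on $\mathcal X$, such that (a) $\beta(f,\varphi)\ge 0$ if $f\ge 0$ and $\varphi\ge 0$, (b) $|\beta(f,\varphi)|\le \|f\|_\infty\|\varphi\|_{TV}$, and (c) $\beta(1,\varphi)=\|\varphi\|_{TV}$ if $\varphi\ge 0$. Let $\mathcal M$ be the set of all generalized decision rules. A Markov kernel $q(dy|x)$ gives the rule $\beta(f,\varphi)=\int_{\mathcal X}\int_{\mathcal Y} f(y)\,q(dy|x)\,d\varphi(x)$. For $\beta\in\mathcal M$ and a probability measure $p$ on $\mathcal X\times\mathcal Y$ with marginal $p_X$ on $\mathcal X$, let $q(y|x)=q_{\beta,p}(y|x)\in[0,1]$ be the density with respect to $p_X$ of the measure $A\mapsto \beta(1_{\{y\}},\,p_X|_A)$, which is determined for $p_X$-almost every $x$, and put $$\mathbb E_p[-\log q(Y|X)]=\int_{\mathcal X\times\mathcal Y}-\log q_{\beta,p}(y|x)\,dp(x,y)\in[0,\infty],\qquad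 -\log 0=\infty.$$ Let $\mathcal D$ be a non-empty convex set of probability measures on $\mathcal X\times\mathcal Y$. Then, in $[0,\infty]$, $$\inf_{\beta\in\mathcal M}\ \sup_{p\in\mathcal D}\ \mathbb E_p[-\log q(Y|X)]\;=\;\sup_{p\in\mathcal D}H_p(Y|X),$$ where $H_p(Y|X)=\int_{\mathcal X}\sum_{y\in\mathcal Y}-p(y|x)\log p(y|x)\,dp_X(x)$ is the conditional Shannon entropy of $Y$ given $X$ for $(X,Y)\sim p$. -/

import Mathlib

open MeasureTheory Set
open scoped ENNReal NNReal BoundedContinuousFunction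

noncomputable section

namespace RobustLearning

/-- A generalized decision rule in the sense of Le Cam and Strasser: a bilinear form on
(bounded continuous functions on `Y`) × (bounded signed measures on `X`) satisfying (a), (b), (c).
A Markov kernel `q` from `X` to `Y` gives the rule `(f, φ) ↦ ∫ ∫ f(y) q(dy|x) φ(dx)`; other rules
do not come from a single Markov kernel. -/
structure GeneralizedDecisionRule (X Y : Type*) [MeasurableSpace X] [TopologicalSpace Y] where
  /-- the bilinear form -/
  form : (Y →ᵇ ℝ) →ₗ[ℝ] SignedMeasure X →ₗ[ℝ] ℝ
  /-- (a) positivity -/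
  nonneg : ∀ (f : Y →ᵇ ℝ) (φ : SignedMeasure X), 0 ≤ f → 0 ≤ φ → 0 ≤ form f φ
  /-- (b) the bound by supremum norm times total variation norm -/
  abs_le : ∀ (f : Y →ᵇ ℝ) (φ : SignedMeasure X), |form f φ| ≤ ‖f‖ * φ.totalVariation.real univ
  /-- (c) normalization -/
  map_one : ∀ φ : SignedMeasure X, 0 ≤ φ → form 1 φ = φ.totalVariation.real univ

/-- The indicator function of a point of a discrete space, as a bounded continuous function. -/
def pointIndicator {Y : Type*} [TopologicalSpace Y] [DiscreteTopology Y] (y : Y) : Y →ᵇ ℝ :=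
  BoundedContinuousFunction.indicator {y} (isClopen_discrete {y})

section Rule

variable {X Y : Type*} [MeasurableSpace X] [TopologicalSpace Y] [DiscreteTopology Y]

/-- The number `β(1_{y}, μ|_A)`, which for the rule of a Markov kernel `q` is
`∫_A q({y}|x) μ(dx)`. -/
def GeneralizedDecisionRule.atomValue (β : GeneralizedDecisionRule X Y) (μ : Measure X)
    [IsFiniteMeasure μ] (y : Y) (A : Set X) : ℝ :=
  β.form (pointIndicator y) (μ.restrict A).toSignedMeasure

lemma pointIndicator_nonneg (y : Y) : 0 ≤ pointIndicator y := by
  intro z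
  exact Set.indicator_nonneg (fun _ _ => zero_le_one) z

lemma norm_pointIndicator_le (y : Y) : ‖pointIndicator y‖ ≤ 1 := by
  refine (BoundedContinuousFunction.norm_le zero_le_one).2 fun z => ?_
  simp only [pointIndicator, BoundedContinuousFunction.indicator_apply]
  by_cases h : z ∈ ({y} : Set Y) <;> simp [Set.indicator, h]

lemma GeneralizedDecisionRule.atomValue_nonneg (β : GeneralizedDecisionRule X Y) (μ : Measure X)
    [IsFiniteMeasure μ] (y : Y) (A : Set X) : 0 ≤ β.atomValue μ y A :=
  β.nonneg _ _ (pointIndicator_nonneg y) (Measure.zero_le_toSignedMeasure _)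

lemma GeneralizedDecisionRule.atomValue_le (β : GeneralizedDecisionRule X Y) (μ : Measure X)
    [IsFiniteMeasure μ] (y : Y) (A : Set X) : β.atomValue μ y A ≤ μ.real A := by
  refine (le_abs_self _).trans ((β.abs_le _ _).trans ?_)
  rw [SignedMeasure.totalVariation_eq_variation, Measure.variation_toSignedMeasure,
    measureReal_restrict_apply_univ]
  exact mul_le_of_le_one_left measureReal_nonneg (norm_pointIndicator_le y)

lemma GeneralizedDecisionRule.atomValue_union (β : GeneralizedDecisionRule X Y) (μ : Measure X)
    [IsFiniteMeasure μ] (y : Y) {A B : Set X} (hAB : Disjoint A B) (hB : MeasurableSet B) :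
    β.atomValue μ y (A ∪ B) = β.atomValue μ y A + β.atomValue μ y B := by
  have h : (μ.restrict (A ∪ B)).toSignedMeasure
      = (μ.restrict A).toSignedMeasure + (μ.restrict B).toSignedMeasure := by
    rw [← Measure.toSignedMeasure_add]
    exact Measure.toSignedMeasure_congr (Measure.restrict_union hAB hB)
  simp only [atomValue, h, map_add]

lemma GeneralizedDecisionRule.hasSum_atomValue (β : GeneralizedDecisionRule X Y) (μ : Measure X)
    [IsFiniteMeasure μ] (y : Y) (A : ℕ → Set X) (hA : ∀ i, MeasurableSet (A i))
    (hd : Pairwise (Function.onFun Disjoint A)) :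
    HasSum (fun i => β.atomValue μ y (A i)) (β.atomValue μ y (⋃ i, A i)) := by
  have key : ∀ n, β.atomValue μ y (⋃ i, A i)
      = ∑ i ∈ Finset.range n, β.atomValue μ y (A i) + β.atomValue μ y (⋃ i ≥ n, A i) := by
    intro n
    induction n with
    | zero => simp
    | succ n ih =>
      have hsplit : (⋃ i ≥ n, A i) = A n ∪ ⋃ i ≥ n + 1, A i := by
        ext x
        simp only [mem_iUnion, mem_union, exists_prop]
        constructor
        · rintro ⟨i, hi, hx⟩
          rcases Nat.eq_or_lt_of_le hi with h | h
          · exact Or.inl (h ▸ hx)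
          · exact Or.inr ⟨i, h, hx⟩
        · rintro (hx | ⟨i, hi, hx⟩)
          · exact ⟨n, le_refl n, hx⟩
          · exact ⟨i, (Nat.le_succ n).trans hi, hx⟩
      have hdisj : Disjoint (A n) (⋃ i ≥ n + 1, A i) := by
        simp only [disjoint_iUnion_right]
        intro i hi
        exact hd (by omega)
      have hmeas : MeasurableSet (⋃ i ≥ n + 1, A i) :=
        MeasurableSet.iUnion fun i => MeasurableSet.iUnion fun _ => hA i
      rw [ih, hsplit, β.atomValue_union μ y hdisj hmeas, Finset.sum_range_succ, add_assoc]
  have htail : Filter.Tendsto (fun n => β.atomValue μ y (⋃ i ≥ n, A i)) Filter.atTop (nhds 0) := by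
    have h0 : Filter.Tendsto (fun n => μ.real (⋃ i ≥ n, A i)) Filter.atTop (nhds 0) := by
      have := tendsto_measure_biUnion_Ici_zero_of_pairwise_disjoint (μ := μ)
        (fun i => (hA i).nullMeasurableSet) hd
      simpa [Measure.real, Function.comp_def] using
        (ENNReal.tendsto_toReal ENNReal.zero_ne_top).comp this
    exact squeeze_zero (fun n => β.atomValue_nonneg μ y _) (fun n => β.atomValue_le μ y _) h0
  rw [hasSum_iff_tendsto_nat_of_nonneg fun i => β.atomValue_nonneg μ y (A i)]
  have h1 : (fun n => ∑ i ∈ Finset.range n, β.atomValue μ y (A i))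
      = fun n => β.atomValue μ y (⋃ i, A i) - β.atomValue μ y (⋃ i ≥ n, A i) := by
    funext n
    linarith [key n]
  rw [h1]
  simpa using htail.const_sub (β.atomValue μ y (⋃ i, A i))

/-- The finite measure `A ↦ β(1_{y}, μ|_A)` on `X`. It is dominated by `μ`. -/
def GeneralizedDecisionRule.atomMeasure (β : GeneralizedDecisionRule X Y) (μ : Measure X)
    [IsFiniteMeasure μ] (y : Y) : Measure X :=
  Measure.ofMeasurable (fun A _ => ENNReal.ofReal (β.atomValue μ y A))
    (by simp [GeneralizedDecisionRule.atomValue])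
    (fun A hA hd => by
      have h := β.hasSum_atomValue μ y A hA hd
      rw [← h.tsum_eq, ENNReal.ofReal_tsum_of_nonneg (fun i => β.atomValue_nonneg μ y _)
        h.summable])

/-- The conditional probability `q(y|x)` that the rule `β` assigns to the label `y` under the
distribution `μ` of the feature: the density with respect to `μ` of `A ↦ β(1_{y}, μ|_A)`. It is
determined up to `μ`-null sets, and there it takes values in `[0, 1]`. For the rule of a Markov
kernel `q` it is `q({y}|x)` for `μ`-almost every `x`. -/
def GeneralizedDecisionRule.condProb (β : GeneralizedDecisionRule X Y) (μ : Measure X)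
    [IsFiniteMeasure μ] (y : Y) (x : X) : ℝ≥0∞ :=
  (β.atomMeasure μ y).rnDeriv μ x

/-- The loss `-log t ∈ [0, ∞]` of a probability `t ∈ [0, 1]`, with `-log 0 = ∞`. -/
def negLog (t : ℝ≥0∞) : ℝ≥0∞ := (-ENNReal.log t).toENNReal

/-- The expected cross-entropy loss `E_p[-log q(Y|X)] ∈ [0, ∞]` of the generalized decision rule
`β` under the joint distribution `p` of `(X, Y)`. -/
def crossEntropy [MeasurableSpace Y] (β : GeneralizedDecisionRule X Y)
    (p : ProbabilityMeasure (X × Y)) : ℝ≥0∞ :=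
  ∫⁻ z, negLog (β.condProb (p : Measure (X × Y)).fst z.2 z.1) ∂(p : Measure (X × Y))

end Rule

section Entropy

variable {X Y : Type*} [MeasurableSpace X] [MeasurableSpace Y]

/-- The posterior probability `p(y|x)`: the density of `A ↦ p(A × {y})` with respect to the
marginal of `p` on `X`. -/
def posterior (p : ProbabilityMeasure (X × Y)) (y : Y) (x : X) : ℝ≥0∞ :=
  (((p : Measure (X × Y)).restrict (Prod.snd ⁻¹' {y})).fst).rnDeriv (p : Measure (X × Y)).fst x

/-- The conditional Shannon entropy `H(Y|X) ∈ [0, ∞]` (in nats) of the discrete variable `Y` given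
`X`, where `(X, Y) ∼ p`: the mean over `x` of the entropy `∑ y, -p(y|x) log p(y|x)`. -/
def condEntropy (p : ProbabilityMeasure (X × Y)) : ℝ≥0∞ :=
  ∫⁻ x, ∑' y, ENNReal.ofReal (Real.negMulLog (posterior p y x).toReal)
    ∂(p : Measure (X × Y)).fst

end Entropy

end RobustLearning

end

/-!
The identity is a minimax theorem for the expected loss `L(β, p) = E_p[-log q_{β,p}(Y|X)]`, combined
with the fact that for each `p` the smallest expected loss is the conditional entropy.

*Bayes risk.* Gibbs' inequality gives `H_p(Y|X) ≤ L(β, p)` for every rule `β`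
(`condEntropy_le_crossEntropy`): the conditional probabilities of a generalized decision rule add up
to at most `1`. The kernel of posterior probabilities attains the bound
(`exists_crossEntropy_eq_condEntropy`). This already yields `≥`.

*Dependence on `p`.* The density `q_{β,p}` does not really depend on `p`: if `ν ≪ μ`, then the
densities computed under `ν` and under `μ` agree `ν`-almost everywhere
(`GeneralizedDecisionRule.condProb_ae_eq_of_absolutelyContinuous`), because the bound (b) makes
`φ ↦ β(1_{y}, φ)` continuous in total variation. Hence `L(β, ·)` is affine (`crossEntropy_eq_sum`).

*Dependence on `β`.* The loss is convex (`crossEntropy_mix_le`), and it is lower semicontinuous for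
pointwise convergence of the bilinear forms (`lowerSemicontinuous_crossEntropy`), because the
tangents of `-log` write it as a supremum of continuous functions. In this topology the generalized
decision rules form a compact space; this is what the passage from kernels to bilinear forms buys.

*Minimax.* Let `c` exceed the supremum of the entropies. By compactness it is enough to find, for
finitely many `p_i ∈ D`, one rule with `L(β, p_i) ≤ c` for all `i`
(`exists_forall_crossEntropy_le`). The vectors that dominate some `(L(β, p_i))_i` form a convex set,
so a separating hyperplane reduces this to making one weighted average of the `L(β, p_i)` smaller
than `c`. The Bayes rule of the corresponding mixture does so, once the weights are perturbed to be
positive, which keeps all `L(β, p_i)` finite.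
-/

open MeasureTheory Set
open scoped ENNReal NNReal BoundedContinuousFunction

namespace RobustLearning

/-! ### The logarithmic loss -/

lemma antitone_negLog : Antitone negLog := fun _ _ h =>
  EReal.toENNReal_le_toENNReal (EReal.neg_le_neg_iff.2 (ENNReal.log_monotone h))

lemma measurable_negLog : Measurable negLog := antitone_negLog.measurable

lemma continuous_negLog : Continuous negLog :=
  EReal.continuous_toENNReal.comp (continuous_neg.comp ENNReal.continuous_log)

@[simp] lemma negLog_zero : negLog 0 = ∞ := by simp [negLog]

lemma negLog_of_one_le {t : ℝ≥0∞} (h : 1 ≤ t) : negLog t = 0 :=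
  EReal.toENNReal_of_nonpos (by simpa using h)

lemma negLog_eq_ofReal {t : ℝ≥0∞} (h0 : t ≠ 0) (ht : t ≠ ∞) :
    negLog t = ENNReal.ofReal (-Real.log t.toReal) := by
  rw [negLog, ENNReal.log_pos_real h0 ht, ← EReal.coe_neg, EReal.toENNReal_of_ne_top (by simp)]
  simp

/-- The graph of `-log` lies above its tangent at `s`, in subtraction-free form. -/
lemma negLog_add_one_le {s : ℝ≥0∞} (h0 : s ≠ 0) (h1 : s ≤ 1) (t : ℝ≥0∞) :
    negLog s + 1 ≤ negLog t + t / s := by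
  have hs : s ≠ ∞ := ne_top_of_le_ne_top ENNReal.one_ne_top h1
  rcases eq_or_ne t 0 with rfl | ht0
  · simp
  rcases eq_or_ne t ∞ with rfl | ht
  · simp [ENNReal.top_div_of_ne_top hs]
  have hs' := ENNReal.toReal_pos h0 hs
  have ht' := ENNReal.toReal_pos ht0 ht
  have hs1 : s.toReal ≤ 1 := ENNReal.toReal_le_of_le_ofReal zero_le_one (by simpa using h1)
  have hlog : -Real.log s.toReal + 1 ≤ -Real.log t.toReal + t.toReal / s.toReal := by
    have := Real.log_le_sub_one_of_pos (div_pos ht' hs')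
    rw [Real.log_div ht'.ne' hs'.ne'] at this
    linarith
  rw [negLog_eq_ofReal h0 hs, negLog_eq_ofReal ht0 ht, ← ENNReal.ofReal_toReal ht,
    ← ENNReal.ofReal_toReal hs, ← ENNReal.ofReal_div_of_pos hs', ← ENNReal.ofReal_one,
    ENNReal.toReal_ofReal hs'.le, ENNReal.toReal_ofReal ht'.le,
    ← ENNReal.ofReal_add (neg_nonneg.2 (Real.log_nonpos hs'.le hs1)) zero_le_one]
  exact (ENNReal.ofReal_le_ofReal hlog).trans ENNReal.ofReal_add_le

lemma mul_negLog_self {a : ℝ≥0∞} (h : a ≠ ∞) :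
    a * negLog a = ENNReal.ofReal (Real.negMulLog a.toReal) := by
  rcases eq_or_ne a 0 with rfl | h0
  · simp
  rw [negLog_eq_ofReal h0 h, Real.negMulLog, neg_mul_comm,
    ENNReal.ofReal_mul ENNReal.toReal_nonneg, ENNReal.ofReal_toReal h]

/-- Gibbs' inequality for one label, in subtraction-free form. -/
lemma ofReal_negMulLog_add_le {a : ℝ≥0∞} (h : a ≤ 1) (b : ℝ≥0∞) :
    ENNReal.ofReal (Real.negMulLog a.toReal) + a ≤ a * negLog b + b := by
  have ha : a ≠ ∞ := ne_top_of_le_ne_top ENNReal.one_ne_top h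
  rcases eq_or_ne a 0 with rfl | h0
  · simp
  have := mul_le_mul_right (negLog_add_one_le h0 h b) a
  rwa [mul_add, mul_add, mul_one, mul_negLog_self ha, ENNReal.mul_div_cancel h0 ha] at this

lemma negLog_convex {a b : ℝ≥0∞} (hab : a + b = 1) (s t : ℝ≥0∞) :
    negLog (a * s + b * t) ≤ a * negLog s + b * negLog t := by
  rcases le_total 1 (a * s + b * t) with h1 | h1
  · simp [negLog_of_one_le h1]
  rcases eq_or_ne (a * s + b * t) 0 with h0 | h0
  · rw [add_eq_zero, mul_eq_zero, mul_eq_zero] at h0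
    rcases h0 with ⟨rfl | rfl, h0⟩
    · simp_all
    · rcases h0 with rfl | rfl
      · simp_all
      · simp [← add_mul, hab]
  have hm : a * s + b * t ≠ ∞ := ne_top_of_le_ne_top ENNReal.one_ne_top h1
  set m := a * s + b * t with hm_def
  have key := add_le_add (mul_le_mul_right (negLog_add_one_le h0 h1 s) a)
    (mul_le_mul_right (negLog_add_one_le h0 h1 t) b)
  rw [← add_mul, hab, one_mul] at key
  have e : a * (negLog s + s / m) + b * (negLog t + t / m)
      = a * negLog s + b * negLog t + 1 := by
    rw [← ENNReal.div_self h0 hm]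
    nth_rw 3 [hm_def]
    simp only [ENNReal.div_eq_inv_mul]
    ring
  rw [e] at key
  exact (ENNReal.add_le_add_iff_right ENNReal.one_ne_top).1 key

/-! ### Conditional probabilities of a generalized decision rule -/

namespace GeneralizedDecisionRule

variable {X Y : Type*} [MeasurableSpace X] [TopologicalSpace Y] [DiscreteTopology Y]
  (β : GeneralizedDecisionRule X Y) (μ : Measure X) [IsFiniteMeasure μ] (y : Y)

lemma atomMeasure_apply {A : Set X} (hA : MeasurableSet A) :
    β.atomMeasure μ y A = ENNReal.ofReal (β.atomValue μ y A) :=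
  Measure.ofMeasurable_apply A hA

lemma atomMeasure_le : β.atomMeasure μ y ≤ μ :=
  Measure.le_iff.2 fun A hA => by
    rw [β.atomMeasure_apply μ y hA]
    exact ENNReal.ofReal_le_of_le_toReal (β.atomValue_le μ y A)

instance : IsFiniteMeasure (β.atomMeasure μ y) :=
  isFiniteMeasure_of_le μ (β.atomMeasure_le μ y)

lemma measurable_condProb : Measurable (β.condProb μ y) := Measure.measurable_rnDeriv _ _

lemma withDensity_condProb : μ.withDensity (β.condProb μ y) = β.atomMeasure μ y :=
  Measure.withDensity_rnDeriv_eq _ _ (Measure.absolutelyContinuous_of_le (β.atomMeasure_le μ y))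

lemma setLIntegral_condProb {A : Set X} (hA : MeasurableSet A) :
    ∫⁻ x in A, β.condProb μ y x ∂μ = ENNReal.ofReal (β.atomValue μ y A) := by
  rw [← withDensity_apply _ hA, β.withDensity_condProb, β.atomMeasure_apply μ y hA]

variable {μ y} in
lemma condProb_ae_eq {g : X → ℝ≥0∞} (hg : Measurable g)
    (h : ∀ A, MeasurableSet A → ∫⁻ x in A, g x ∂μ = ENNReal.ofReal (β.atomValue μ y A)) :
    β.condProb μ y =ᵐ[μ] g :=
  ae_eq_of_forall_setLIntegral_eq_of_sigmaFinite (β.measurable_condProb μ y) hg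
    fun A hA _ => by rw [β.setLIntegral_condProb μ y hA, h A hA]

lemma condProb_le_one : ∀ᵐ x ∂μ, β.condProb μ y x ≤ 1 :=
  ae_le_of_forall_setLIntegral_le_of_sigmaFinite (β.measurable_condProb μ y) fun A hA _ => by
    rw [β.setLIntegral_condProb μ y hA, setLIntegral_one]
    exact ENNReal.ofReal_le_of_le_toReal (β.atomValue_le μ y A)

/-- The conditional probabilities of the labels add up to at most `1`. They may add up to less,
since a generalized decision rule is only finitely additive in the label. -/
lemma tsum_condProb_le_one [Countable Y] : ∀ᵐ x ∂μ, ∑' y, β.condProb μ y x ≤ 1 := by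
  have hT : ∀ T : Finset Y, ∀ᵐ x ∂μ, ∑ y ∈ T, β.condProb μ y x ≤ 1 := fun T => by
    refine ae_le_of_forall_setLIntegral_le_of_sigmaFinite
      (Finset.measurable_sum T fun y _ => β.measurable_condProb μ y) fun A hA _ => ?_
    rw [lintegral_finsetSum _ fun y _ => β.measurable_condProb μ y, setLIntegral_one]
    simp_rw [β.setLIntegral_condProb μ _ hA]
    rw [← ENNReal.ofReal_sum_of_nonneg fun y _ => β.atomValue_nonneg μ y A]
    refine ENNReal.ofReal_le_of_le_toReal ?_
    have hsum : ∑ y ∈ T, β.atomValue μ y A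
        = β.form (∑ y ∈ T, pointIndicator y) (μ.restrict A).toSignedMeasure := by
      simp [atomValue]
    have hnorm : ‖∑ y ∈ T, pointIndicator y‖ ≤ 1 := by
      classical
      refine (BoundedContinuousFunction.norm_le zero_le_one).2 fun z => ?_
      simp only [BoundedContinuousFunction.sum_apply, pointIndicator,
        BoundedContinuousFunction.indicator_apply, Set.indicator_apply, mem_singleton_iff,
        Pi.one_apply, Finset.sum_ite_eq]
      split_ifs <;> simp
    rw [hsum]
    refine (le_abs_self _).trans ((β.abs_le _ _).trans ?_)
    rw [SignedMeasure.totalVariation_eq_variation, Measure.variation_toSignedMeasure,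
      measureReal_restrict_apply_univ]
    exact mul_le_of_le_one_left measureReal_nonneg hnorm
  filter_upwards [ae_all_iff.2 hT] with x hx
  rw [ENNReal.tsum_eq_iSup_sum]
  exact iSup_le hx

section Consistency

/-- The mass `β(1_{y}, ν)` that the rule gives to the label `y` under the finite measure `ν`. -/
noncomputable def mass (ν : Measure X) [IsFiniteMeasure ν] (y : Y) : ℝ≥0∞ :=
  ENNReal.ofReal (β.form (pointIndicator y) ν.toSignedMeasure)

variable {μ} in
lemma mass_congr {ν : Measure X} [IsFiniteMeasure ν] (h : μ = ν) : β.mass μ y = β.mass ν y := by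
  subst h; rfl

lemma form_nonneg : 0 ≤ β.form (pointIndicator y) μ.toSignedMeasure :=
  β.nonneg _ _ (pointIndicator_nonneg y) (Measure.zero_le_toSignedMeasure _)

lemma mass_restrict {A : Set X} :
    β.mass (μ.restrict A) y = ENNReal.ofReal (β.atomValue μ y A) := rfl

lemma mass_le : β.mass μ y ≤ μ univ := by
  rw [← β.mass_congr y Measure.restrict_univ, mass_restrict]
  exact ENNReal.ofReal_le_of_le_toReal (β.atomValue_le μ y univ)

lemma mass_add (ν : Measure X) [IsFiniteMeasure ν] :
    β.mass (μ + ν) y = β.mass μ y + β.mass ν y := by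
  rw [mass, mass, mass, Measure.toSignedMeasure_add, map_add,
    ENNReal.ofReal_add (β.form_nonneg μ y) (β.form_nonneg ν y)]

lemma mass_smul (c : ℝ≥0) : β.mass (c • μ) y = c * β.mass μ y := by
  rw [mass, mass, Measure.toSignedMeasure_smul, NNReal.smul_def, map_smul, smul_eq_mul,
    ENNReal.ofReal_mul c.coe_nonneg, ENNReal.ofReal_coe_nnreal]

/-- Under any finite measure dominated by `μ`, the mass of a label is the integral of the
conditional probability computed under `μ`. Condition (b) makes the passage from simple
densities to general ones possible. -/
lemma mass_withDensity {h : X → ℝ≥0∞} (hh : Measurable h)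
    (hfin : IsFiniteMeasure (μ.withDensity h)) :
    β.mass (μ.withDensity h) y = ∫⁻ x, h x * β.condProb μ y x ∂μ := by
  refine Measurable.ennreal_induction (motive := fun h => ∀ _ : IsFiniteMeasure (μ.withDensity h),
    β.mass (μ.withDensity h) y = ∫⁻ x, h x * β.condProb μ y x ∂μ) ?_ ?_ ?_ hh hfin
  · intro c s hs hfin
    have hR : ∫⁻ x, s.indicator (fun _ => c) x * β.condProb μ y x ∂μ
        = c * β.mass (μ.restrict s) y := by
      rw [mass_restrict, ← β.setLIntegral_condProb μ y hs,
        ← lintegral_const_mul _ (β.measurable_condProb μ y), ← lintegral_indicator hs]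
      congr 1 with x
      by_cases hx : x ∈ s <;> simp [hx]
    have hw : μ.withDensity (s.indicator fun _ => c) = c • μ.restrict s := by
      rw [withDensity_indicator hs, withDensity_const]
    rw [hR]
    rcases eq_or_ne c ∞ with rfl | hc
    · have hz : μ.restrict s = 0 := by
        have := measure_ne_top (μ.withDensity (s.indicator fun _ => ∞)) univ
        rw [hw] at this
        rw [← Measure.measure_univ_eq_zero]
        by_contra h0
        exact this (by simp only [Measure.smul_apply, smul_eq_mul, ENNReal.top_mul h0])
      have hw0 : μ.withDensity (s.indicator fun _ => ∞) = 0 := by rw [hw, hz, smul_zero]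
      rw [β.mass_congr y hw0, β.mass_congr y hz]
      simp [mass]
    · lift c to ℝ≥0 using hc
      rw [β.mass_congr (ν := c • μ.restrict s) y hw, mass_smul]
  · intro f g _ hf hg ihf ihg hfin
    have hadd := withDensity_add_left hf (μ := μ) g
    have hf' : IsFiniteMeasure (μ.withDensity f) := isFiniteMeasure_of_le (μ.withDensity (f + g))
      (hadd ▸ Measure.le_add_right le_rfl)
    have hg' : IsFiniteMeasure (μ.withDensity g) := isFiniteMeasure_of_le (μ.withDensity (f + g))
      (hadd ▸ Measure.le_add_left le_rfl)
    rw [β.mass_congr y hadd, mass_add, ihf hf', ihg hg']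
    simp only [Pi.add_apply, add_mul]
    exact (lintegral_add_left (hf.mul (β.measurable_condProb μ y)) _).symm
  · intro f hf hmono ih hfin
    set F : X → ℝ≥0∞ := fun x => ⨆ n, f n x with hF
    have hFm : Measurable F := .iSup hf
    have hle : ∀ n, f n ≤ F := fun n x => le_iSup (fun n => f n x) n
    have hfn : ∀ n, IsFiniteMeasure (μ.withDensity (f n)) := fun n =>
      isFiniteMeasure_of_le (μ.withDensity F) (withDensity_mono (ae_of_all _ (hle n)))
    have hFint : ∫⁻ x, F x ∂μ ≠ ∞ := by
      simpa using measure_ne_top (μ.withDensity F) univ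
    have hdiff : ∀ n, IsFiniteMeasure (μ.withDensity (F - f n)) := fun n =>
      isFiniteMeasure_of_le (μ.withDensity F)
        (withDensity_mono (ae_of_all _ fun x => tsub_le_self))
    have hsplit : ∀ n, μ.withDensity F = μ.withDensity (f n) + μ.withDensity (F - f n) := by
      intro n
      rw [← withDensity_add_left (hf n), add_tsub_cancel_of_le (hle n)]
    -- the remainder has mass at most `∫ (F - f n) dμ`, which tends to zero
    have htail : Filter.Tendsto (fun n => ∫⁻ x, (F - f n) x ∂μ) Filter.atTop (nhds 0) := by
      have := tendsto_lintegral_of_dominated_convergence (μ := μ) (F := fun n => F - f n)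
        (f := fun _ => 0) F (fun n => hFm.sub (hf n))
        (fun n => ae_of_all _ fun x => tsub_le_self) hFint ?_
      · simpa using this
      · filter_upwards [ae_lt_top hFm hFint] with x hx
        have h1 : Filter.Tendsto (fun n => f n x) Filter.atTop (nhds (F x)) :=
          tendsto_atTop_iSup fun m n hmn => hmono hmn x
        simpa using ENNReal.Tendsto.sub (tendsto_const_nhds (x := F x)) h1 (Or.inl hx.ne)
    have hlim1 : Filter.Tendsto (fun n => ∫⁻ x, f n x * β.condProb μ y x ∂μ) Filter.atTop
        (nhds (∫⁻ x, F x * β.condProb μ y x ∂μ)) := by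
      refine lintegral_tendsto_of_tendsto_of_monotone
        (fun n => ((hf n).mul (β.measurable_condProb μ y)).aemeasurable)
        (ae_of_all _ fun x m n hmn => mul_le_mul_left (hmono hmn x) _) ?_
      filter_upwards [β.condProb_le_one μ y] with x hx
      exact ENNReal.Tendsto.mul_const (tendsto_atTop_iSup fun m n hmn => hmono hmn x)
        (Or.inr (ne_top_of_le_ne_top ENNReal.one_ne_top hx))
    refine le_antisymm ?_ ?_
    · have := hlim1.add htail
      rw [add_zero] at this
      refine ge_of_tendsto' this fun n => ?_
      rw [β.mass_congr y (hsplit n), mass_add, ih n (hfn n)]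
      gcongr
      simpa using β.mass_le (μ.withDensity (F - f n)) y
    · refine le_of_tendsto' hlim1 fun n => ?_
      rw [← ih n (hfn n), β.mass_congr y (hsplit n), mass_add]
      exact le_self_add

/-- The conditional probabilities do not depend on the distribution of the feature: under
`ν ≪ μ` they may be computed from `μ`. -/
lemma condProb_ae_eq_of_absolutelyContinuous {ν : Measure X} [IsFiniteMeasure ν] (hν : ν ≪ μ) :
    β.condProb ν y =ᵐ[ν] β.condProb μ y := by
  refine β.condProb_ae_eq (β.measurable_condProb μ y) fun A hA => ?_
  set h := ν.rnDeriv μ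
  have hd : μ.withDensity h = ν := Measure.withDensity_rnDeriv_eq ν μ hν
  have hm : Measurable h := Measure.measurable_rnDeriv ν μ
  have hA' : ν.restrict A = μ.withDensity (A.indicator h) := by
    rw [withDensity_indicator hA, ← restrict_withDensity hA, hd]
  have : IsFiniteMeasure (μ.withDensity (A.indicator h)) := hA' ▸ inferInstance
  rw [← mass_restrict, β.mass_congr y hA', β.mass_withDensity μ y (hm.indicator hA) this,
    hA', lintegral_withDensity_eq_lintegral_mul _ (hm.indicator hA) (β.measurable_condProb μ y)]
  rfl

end Consistency

end GeneralizedDecisionRule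

/-! ### The compact space of generalized decision rules -/

namespace GeneralizedDecisionRule

section Topology

variable {X Y : Type*} [MeasurableSpace X] [TopologicalSpace Y]

/-- The topology of pointwise convergence of the bilinear forms. -/
instance : TopologicalSpace (GeneralizedDecisionRule X Y) :=
  .induced (fun β (fφ : (Y →ᵇ ℝ) × SignedMeasure X) => β.form fφ.1 fφ.2) inferInstance

lemma continuous_form (f : Y →ᵇ ℝ) (φ : SignedMeasure X) :
    Continuous fun β : GeneralizedDecisionRule X Y => β.form f φ := by
  have h : Continuous fun (β : GeneralizedDecisionRule X Y) (fφ : (Y →ᵇ ℝ) × SignedMeasure X) =>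
      β.form fφ.1 fφ.2 := continuous_induced_dom
  exact (continuous_apply (f, φ)).comp h

/-- Tychonoff's theorem: the bound (b) confines every value of the form to a compact interval, and
bilinearity and (a), (b), (c) survive pointwise limits. -/
instance : CompactSpace (GeneralizedDecisionRule X Y) := by
  refine ⟨isCompact_iff_ultrafilter_le_nhds'.2 fun U _ => ?_⟩
  have hlim : ∀ (f : Y →ᵇ ℝ) (φ : SignedMeasure X), ∃ l : ℝ,
      Filter.Tendsto (fun β : GeneralizedDecisionRule X Y => β.form f φ) U (nhds l) := by
    intro f φ
    obtain ⟨l, -, hl⟩ := (isCompact_Icc (a := -(‖f‖ * φ.totalVariation.real univ))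
      (b := ‖f‖ * φ.totalVariation.real univ)).ultrafilter_le_nhds'
      (U.map fun β : GeneralizedDecisionRule X Y => β.form f φ)
      (Filter.mem_map.2 (Filter.univ_mem' fun β => _root_.abs_le.1 (β.abs_le f φ)))
    exact ⟨l, hl⟩
  choose l hl using hlim
  let β₀ : GeneralizedDecisionRule X Y :=
    { form := LinearMap.mk₂ ℝ l
        (fun f g φ => tendsto_nhds_unique (hl (f + g) φ)
          (by simpa using (hl f φ).add (hl g φ)))
        (fun c f φ => tendsto_nhds_unique (hl (c • f) φ)
          (by simpa using (hl f φ).const_mul c))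
        (fun f φ ψ => tendsto_nhds_unique (hl f (φ + ψ))
          (by simpa using (hl f φ).add (hl f ψ)))
        (fun c f φ => tendsto_nhds_unique (hl f (c • φ))
          (by simpa using (hl f φ).const_mul c))
      nonneg := fun f φ hf hφ => ge_of_tendsto' (hl f φ) fun β => β.nonneg f φ hf hφ
      abs_le := fun f φ => le_of_tendsto' (hl f φ).abs fun β => β.abs_le f φ
      map_one := fun φ hφ => tendsto_nhds_unique (hl 1 φ)
        (by simp [fun β : GeneralizedDecisionRule X Y => β.map_one φ hφ]) }
  refine ⟨β₀, mem_univ _, ?_⟩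
  rw [nhds_induced, ← Filter.tendsto_iff_comap]
  exact tendsto_pi_nhds.2 fun fφ => hl fφ.1 fφ.2

/-- The convex combination of two generalized decision rules. -/
noncomputable def mix {a b : ℝ} (ha : 0 ≤ a) (hb : 0 ≤ b) (hab : a + b = 1)
    (β γ : GeneralizedDecisionRule X Y) : GeneralizedDecisionRule X Y where
  form := a • β.form + b • γ.form
  nonneg f φ hf hφ := by
    simpa using add_nonneg (mul_nonneg ha (β.nonneg f φ hf hφ)) (mul_nonneg hb (γ.nonneg f φ hf hφ))
  abs_le f φ := by
    simp only [LinearMap.add_apply, LinearMap.smul_apply, smul_eq_mul]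
    calc |a * β.form f φ + b * γ.form f φ|
        ≤ |a * β.form f φ| + |b * γ.form f φ| := abs_add_le _ _
      _ = a * |β.form f φ| + b * |γ.form f φ| := by
        rw [abs_mul, abs_mul, abs_of_nonneg ha, abs_of_nonneg hb]
      _ ≤ a * (‖f‖ * φ.totalVariation.real univ) + b * (‖f‖ * φ.totalVariation.real univ) := by
        gcongr
        · exact β.abs_le f φ
        · exact γ.abs_le f φ
      _ = ‖f‖ * φ.totalVariation.real univ := by rw [← add_mul, hab, one_mul]
  map_one φ hφ := by
    simp [β.map_one φ hφ, γ.map_one φ hφ, ← add_mul, hab]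

end Topology

variable {X Y : Type*} [MeasurableSpace X] [TopologicalSpace Y] [DiscreteTopology Y]

lemma continuous_mass (ν : Measure X) [IsFiniteMeasure ν] (y : Y) :
    Continuous fun β : GeneralizedDecisionRule X Y => β.mass ν y :=
  ENNReal.continuous_ofReal.comp (continuous_form _ _)

lemma condProb_mix {a b : ℝ} (ha : 0 ≤ a) (hb : 0 ≤ b) (hab : a + b = 1)
    (β γ : GeneralizedDecisionRule X Y) (μ : Measure X) [IsFiniteMeasure μ] (y : Y) :
    (mix ha hb hab β γ).condProb μ y =ᵐ[μ] fun x =>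
      ENNReal.ofReal a * β.condProb μ y x + ENNReal.ofReal b * γ.condProb μ y x := by
  refine condProb_ae_eq _ (((β.measurable_condProb μ y).const_mul _).add
    ((γ.measurable_condProb μ y).const_mul _)) fun A hA => ?_
  rw [lintegral_add_left ((β.measurable_condProb μ y).const_mul _),
    lintegral_const_mul _ (β.measurable_condProb μ y),
    lintegral_const_mul _ (γ.measurable_condProb μ y), β.setLIntegral_condProb μ y hA,
    γ.setLIntegral_condProb μ y hA, ← ENNReal.ofReal_mul ha, ← ENNReal.ofReal_mul hb,
    ← ENNReal.ofReal_add (mul_nonneg ha (β.atomValue_nonneg μ y A))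
      (mul_nonneg hb (γ.atomValue_nonneg μ y A))]
  rfl

/-! ### The expected loss as a function of the rule -/

/-- The expected loss at one label is lower semicontinuous in the rule. By the tangent inequality
it is a supremum of functions `β ↦ C_s - β(1_{y}, s⁻¹ ν)`, which are continuous. -/
lemma lowerSemicontinuous_lintegral_negLog (ν : Measure X) [IsFiniteMeasure ν] (y : Y) :
    LowerSemicontinuous fun β : GeneralizedDecisionRule X Y =>
      ∫⁻ x, negLog (β.condProb ν y x) ∂ν := by
  intro β₀ a ha
  -- the slope is taken at the conditional probability of `β₀` itself, kept away from `0`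
  let s : ℕ → X → ℝ≥0∞ := fun n x => min 1 (max (β₀.condProb ν y x) ((n : ℝ≥0∞) + 1)⁻¹)
  have hs_meas : ∀ n, Measurable (s n) := fun n =>
    measurable_const.min ((β₀.measurable_condProb ν y).max measurable_const)
  have hlim : Filter.Tendsto (fun n => ∫⁻ x, negLog (s n x) ∂ν) Filter.atTop
      (nhds (∫⁻ x, negLog (β₀.condProb ν y x) ∂ν)) := by
    refine lintegral_tendsto_of_tendsto_of_monotone
      (fun n => (measurable_negLog.comp (hs_meas n)).aemeasurable)
      (ae_of_all _ fun x m n hmn => antitone_negLog ?_) ?_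
    · dsimp only [s]
      gcongr
    · filter_upwards [β₀.condProb_le_one ν y] with x hx
      refine (continuous_negLog.tendsto _).comp ?_
      have h0 : Filter.Tendsto (fun n : ℕ => ((n : ℝ≥0∞) + 1)⁻¹) Filter.atTop (nhds 0) := by
        have := (Filter.tendsto_add_atTop_iff_nat 1).2 ENNReal.tendsto_inv_nat_nhds_zero
        simpa using this
      have := (tendsto_const_nhds (x := (1 : ℝ≥0∞))).min
        ((tendsto_const_nhds (x := β₀.condProb ν y x)).max h0)
      rwa [max_eq_left (zero_le), min_eq_right hx] at this
  obtain ⟨n, hn⟩ := (hlim.eventually (lt_mem_nhds ha)).exists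
  have hs1 : ∀ x, s n x ≤ 1 := fun x => min_le_left _ _
  have hsε : ∀ x, ((n : ℝ≥0∞) + 1)⁻¹ ≤ s n x := fun x =>
    le_min (ENNReal.inv_le_one.2 le_add_self) (le_max_right _ _)
  have hs0 : ∀ x, s n x ≠ 0 := fun x h => by
    have := hsε x
    rw [h, nonpos_iff_eq_zero, ENNReal.inv_eq_zero] at this
    exact ENNReal.add_ne_top.2 ⟨ENNReal.natCast_ne_top n, ENNReal.one_ne_top⟩ this
  have hs_top : ∀ x, s n x ≠ ∞ := fun x => ne_top_of_le_ne_top ENNReal.one_ne_top (hs1 x)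
  have hfin : IsFiniteMeasure (ν.withDensity fun x => (s n x)⁻¹) := by
    refine isFiniteMeasure_withDensity (ne_top_of_le_ne_top ?_ (lintegral_mono fun x =>
      (ENNReal.inv_le_inv.2 (hsε x))))
    simp [ENNReal.mul_eq_top]
  set κ := ν.withDensity fun x => (s n x)⁻¹
  have hmass : ∀ β : GeneralizedDecisionRule X Y,
      β.mass κ y = ∫⁻ x, (s n x)⁻¹ * β.condProb ν y x ∂ν := fun β =>
    β.mass_withDensity ν y (hs_meas n).inv hfin
  have hmass₀ : β₀.mass κ y ≤ ν univ := by
    rw [hmass, ← lintegral_one]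
    refine lintegral_mono_ae ?_
    filter_upwards [β₀.condProb_le_one ν y] with x hx
    calc (s n x)⁻¹ * β₀.condProb ν y x ≤ (s n x)⁻¹ * s n x := by
          gcongr
          exact le_min hx (le_max_left _ _)
      _ = 1 := ENNReal.inv_mul_cancel (hs0 x) (hs_top x)
  have htangent : ∀ β : GeneralizedDecisionRule X Y, ∫⁻ x, negLog (s n x) ∂ν + ν univ
      ≤ ∫⁻ x, negLog (β.condProb ν y x) ∂ν + β.mass κ y := fun β => by
    rw [hmass, ← lintegral_one, ← lintegral_add_right _ measurable_const,
      ← lintegral_add_right (g := fun x => (s n x)⁻¹ * β.condProb ν y x) _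
        ((hs_meas n).inv.mul (β.measurable_condProb ν y))]
    refine lintegral_mono fun x => ?_
    rw [← ENNReal.div_eq_inv_mul]
    exact negLog_add_one_le (hs0 x) (hs1 x) _
  have hlt : β₀.mass κ y < ν univ + (∫⁻ x, negLog (s n x) ∂ν - a) :=
    hmass₀.trans_lt (ENNReal.lt_add_right (measure_ne_top ν univ) (tsub_pos_of_lt hn).ne')
  filter_upwards [(continuous_mass κ y).continuousAt.eventually (gt_mem_nhds hlt)] with β hβ
  by_contra! hle
  have hcontra := (htangent β).trans_lt ((add_le_add_left hle _).trans_lt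
    (ENNReal.add_lt_add_left ha.ne_top hβ))
  rw [add_left_comm, add_tsub_cancel_of_le hn.le, add_comm] at hcontra
  exact lt_irrefl _ hcontra

end GeneralizedDecisionRule

section CrossEntropy

variable {X Y : Type*} [MeasurableSpace X] [Countable Y] [MeasurableSpace Y]
  [DiscreteMeasurableSpace Y]

/-- The part of a joint distribution that carries the label `y`, as a measure on features. -/
noncomputable abbrev labelMeasure (p : Measure (X × Y)) (y : Y) : Measure X :=
  (p.restrict (Prod.snd ⁻¹' {y})).fst

omit [Countable Y] [DiscreteMeasurableSpace Y] in
lemma labelMeasure_le_fst (p : Measure (X × Y)) (y : Y) : labelMeasure p y ≤ p.fst :=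
  Measure.map_mono Measure.restrict_le_self measurable_fst

lemma lintegral_eq_tsum_labelMeasure (p : Measure (X × Y)) {g : X × Y → ℝ≥0∞}
    (hg : Measurable g) :
    ∫⁻ z, g z ∂p = ∑' y, ∫⁻ x, g (x, y) ∂(labelMeasure p y) := by
  have hm : ∀ y : Y, MeasurableSet (Prod.snd ⁻¹' {y} : Set (X × Y)) := fun y =>
    measurable_snd (measurableSet_singleton y)
  have hU : (⋃ y : Y, (Prod.snd ⁻¹' {y} : Set (X × Y))) = univ := by ext; simp
  rw [← setLIntegral_univ, ← hU, lintegral_iUnion hm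
    (fun y y' h => Disjoint.preimage _ (by simpa using h))]
  congr 1 with y
  rw [labelMeasure, Measure.fst,
    lintegral_map (f := fun x => g (x, y)) (hg.comp measurable_prodMk_right) measurable_fst]
  exact setLIntegral_congr_fun (hm y) fun z (hz : z.2 = y) => by rw [← hz]

omit [DiscreteMeasurableSpace Y] in
lemma ae_of_forall_ae_fst {p : Measure (X × Y)} {P : X → Y → Prop}
    (h : ∀ y, ∀ᵐ x ∂p.fst, P x y) : ∀ᵐ z ∂p, P z.1 z.2 := by
  filter_upwards [ae_of_ae_map measurable_fst.aemeasurable (ae_all_iff.2 h)] with z hz using hz z.2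

variable [TopologicalSpace Y] [DiscreteTopology Y]

lemma measurable_negLog_condProb (β : GeneralizedDecisionRule X Y) (μ : Measure X)
    [IsFiniteMeasure μ] : Measurable fun z : X × Y => negLog (β.condProb μ z.2 z.1) :=
  measurable_from_prod_countable_left fun y => measurable_negLog.comp (β.measurable_condProb μ y)

lemma lowerSemicontinuous_crossEntropy (p : ProbabilityMeasure (X × Y)) :
    LowerSemicontinuous fun β : GeneralizedDecisionRule X Y => crossEntropy β p := by
  have h : ∀ β : GeneralizedDecisionRule X Y, crossEntropy β p = ∑' y,
      ∫⁻ x, negLog (β.condProb (labelMeasure (p : Measure (X × Y)) y) y x)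
        ∂(labelMeasure (p : Measure (X × Y)) y) := fun β => by
    rw [crossEntropy, lintegral_eq_tsum_labelMeasure _ (measurable_negLog_condProb β _)]
    congr 1 with y
    refine lintegral_congr_ae ?_
    filter_upwards [β.condProb_ae_eq_of_absolutelyContinuous (p : Measure (X × Y)).fst y
      (Measure.absolutelyContinuous_of_le (labelMeasure_le_fst _ y))] with x hx
    rw [hx]
  simp_rw [h]
  exact lowerSemicontinuous_tsum fun y =>
    GeneralizedDecisionRule.lowerSemicontinuous_lintegral_negLog _ y

lemma crossEntropy_mix_le {a b : ℝ} (ha : 0 ≤ a) (hb : 0 ≤ b) (hab : a + b = 1)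
    (β γ : GeneralizedDecisionRule X Y) (p : ProbabilityMeasure (X × Y)) :
    crossEntropy (.mix ha hb hab β γ) p
      ≤ ENNReal.ofReal a * crossEntropy β p + ENNReal.ofReal b * crossEntropy γ p := by
  have hab' : ENNReal.ofReal a + ENNReal.ofReal b = 1 := by
    rw [← ENNReal.ofReal_add ha hb, hab, ENNReal.ofReal_one]
  unfold crossEntropy
  rw [← lintegral_const_mul _ (measurable_negLog_condProb β _),
    ← lintegral_const_mul _ (measurable_negLog_condProb γ _),
    ← lintegral_add_left ((measurable_negLog_condProb β _).const_mul _)]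
  refine lintegral_mono_ae ?_
  filter_upwards [ae_of_forall_ae_fst (p := (p : Measure (X × Y)))
    (GeneralizedDecisionRule.condProb_mix ha hb hab β γ _)] with z hz
  rw [hz]
  exact negLog_convex hab' _ _

omit [DiscreteMeasurableSpace Y] in
/-- The expected loss is an integral against `p` of a function that does not depend on `p`, as
long as the marginal of `p` is dominated by a fixed measure. -/
lemma crossEntropy_eq_of_absolutelyContinuous (β : GeneralizedDecisionRule X Y)
    (p : ProbabilityMeasure (X × Y)) (μ : Measure X) [IsFiniteMeasure μ]
    (h : (p : Measure (X × Y)).fst ≪ μ) :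
    crossEntropy β p = ∫⁻ z, negLog (β.condProb μ z.2 z.1) ∂(p : Measure (X × Y)) := by
  refine lintegral_congr_ae ?_
  filter_upwards [ae_of_forall_ae_fst (p := (p : Measure (X × Y)))
    fun y => β.condProb_ae_eq_of_absolutelyContinuous μ y h] with z hz
  rw [hz]

omit [DiscreteMeasurableSpace Y] in
/-- The expected loss of a fixed rule is affine in the joint distribution. -/
lemma crossEntropy_eq_sum {ι : Type*} [Fintype ι] (β : GeneralizedDecisionRule X Y)
    (p : ι → ProbabilityMeasure (X × Y)) (w : ι → ℝ≥0) (hw : ∀ i, w i ≠ 0)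
    (r : ProbabilityMeasure (X × Y))
    (hr : (r : Measure (X × Y)) = ∑ i, w i • (p i : Measure (X × Y))) :
    crossEntropy β r = ∑ i, w i * crossEntropy β (p i) := by
  have hac : ∀ i, (p i : Measure (X × Y)).fst ≪ (r : Measure (X × Y)).fst := fun i => by
    refine Measure.AbsolutelyContinuous.map ?_ measurable_fst
    refine Measure.AbsolutelyContinuous.mk fun s _ hs => ?_
    rw [hr, Measure.finsetSum_apply, Finset.sum_eq_zero_iff] at hs
    simpa [hw i] using hs i (Finset.mem_univ i)
  simp_rw [fun i => crossEntropy_eq_of_absolutelyContinuous β (p i) _ (hac i)]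
  have hsum : ∀ g : X × Y → ℝ≥0∞, ∫⁻ z, g z ∂(r : Measure (X × Y))
      = ∑ i, w i * ∫⁻ z, g z ∂(p i : Measure (X × Y)) := fun g => by
    rw [hr, lintegral_finsetSum_measure]
    simp only [lintegral_smul_measure, ENNReal.smul_def, smul_eq_mul]
  exact hsum _

end CrossEntropy

/-! ### Markov kernels as decision rules -/

section Kernel

open ProbabilityTheory

instance {X : Type*} [MeasurableSpace X] (φ : SignedMeasure X) : IsFiniteMeasure φ.variation := by
  rw [← SignedMeasure.totalVariation_eq_variation]
  unfold SignedMeasure.totalVariation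
  infer_instance

lemma exists_eq_toSignedMeasure {X : Type*} [MeasurableSpace X] {φ : SignedMeasure X}
    (hφ : 0 ≤ φ) : ∃ (μ : Measure X) (_ : IsFiniteMeasure μ), φ = μ.toSignedMeasure :=
  ⟨_, inferInstance, (SignedMeasure.toMeasureOfZeroLE_toSignedMeasure φ
    ((VectorMeasure.le_restrict_univ_iff_le _ _).2 hφ)).symm⟩

variable {X Y : Type*} [MeasurableSpace X] [Countable Y] [TopologicalSpace Y]
  [MeasurableSpace Y] [DiscreteMeasurableSpace Y]

omit [MeasurableSpace X] in
lemma integrable_boundedContinuous (μ : Measure Y) [IsFiniteMeasure μ] (f : Y →ᵇ ℝ) :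
    Integrable f μ :=
  .of_bound (StronglyMeasurable.of_discrete).aestronglyMeasurable ‖f‖
    (ae_of_all _ f.norm_coe_le_norm)

omit [MeasurableSpace X] [Countable Y] [DiscreteMeasurableSpace Y] in
lemma norm_integral_boundedContinuous_le (μ : Measure Y) [IsProbabilityMeasure μ] (f : Y →ᵇ ℝ) :
    ‖∫ y, f y ∂μ‖ ≤ ‖f‖ := by
  simpa using norm_integral_le_of_norm_le_const (μ := μ) (ae_of_all _ f.norm_coe_le_norm)

lemma integrable_integral_kernel (κ : Kernel X Y) [IsMarkovKernel κ] (f : Y →ᵇ ℝ)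
    (μ : Measure X) [IsFiniteMeasure μ] : Integrable (fun x => ∫ y, f y ∂(κ x)) μ :=
  .of_bound (StronglyMeasurable.integral_kernel
    (StronglyMeasurable.of_discrete)).aestronglyMeasurable ‖f‖
    (ae_of_all _ fun x => norm_integral_boundedContinuous_le (κ x) f)

/-- The generalized decision rule `(f, φ) ↦ ∫ ∫ f(y) κ(dy|x) φ(dx)` of a Markov kernel `κ`. -/
noncomputable def GeneralizedDecisionRule.ofKernel (κ : Kernel X Y) [IsMarkovKernel κ] :
    GeneralizedDecisionRule X Y where
  form := LinearMap.mk₂ ℝ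
    (fun f φ => VectorMeasure.integral φ (fun x => ∫ y, f y ∂(κ x))
      (ContinuousLinearMap.lsmul ℝ ℝ).flip)
    (fun f g φ => by
      rw [← VectorMeasure.integral_fun_add (integrable_integral_kernel κ f _)
        (integrable_integral_kernel κ g _)]
      congr 1 with x
      exact integral_add (integrable_boundedContinuous _ f) (integrable_boundedContinuous _ g))
    (fun c f φ => by
      rw [← VectorMeasure.integral_fun_smul]
      congr 1 with x
      exact integral_smul c f)
    (fun f φ ψ => VectorMeasure.integral_add_vectorMeasure (integrable_integral_kernel κ f _)
      (integrable_integral_kernel κ f _))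
    (fun c f φ => VectorMeasure.integral_smul_vectorMeasure _ c)
  nonneg f φ hf hφ := by
    obtain ⟨μ, _, rfl⟩ := exists_eq_toSignedMeasure hφ
    rw [LinearMap.mk₂_apply, VectorMeasure.integral_toSignedMeasure]
    exact integral_nonneg fun x => integral_nonneg hf
  abs_le f φ := by
    rw [LinearMap.mk₂_apply, SignedMeasure.totalVariation_eq_variation]
    have hB : ‖(ContinuousLinearMap.lsmul ℝ ℝ : ℝ →L[ℝ] ℝ →L[ℝ] ℝ).flip‖ ≤ 1 := by
      rw [ContinuousLinearMap.opNorm_flip]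
      exact ContinuousLinearMap.opNorm_lsmul_le
    refine (VectorMeasure.norm_integral_le_of_norm_le_const (μ := φ)
      (f := fun x => ∫ y, f y ∂(κ x)) (B := (ContinuousLinearMap.lsmul ℝ ℝ).flip)
      (ae_of_all _ fun x => norm_integral_boundedContinuous_le (κ x) f)).trans ?_
    gcongr
    exact mul_le_of_le_one_right (norm_nonneg _) hB
  map_one φ hφ := by
    obtain ⟨μ, _, rfl⟩ := exists_eq_toSignedMeasure hφ
    rw [LinearMap.mk₂_apply, VectorMeasure.integral_toSignedMeasure,
      SignedMeasure.totalVariation_eq_variation, Measure.variation_toSignedMeasure]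
    simp

lemma GeneralizedDecisionRule.condProb_ofKernel [DiscreteTopology Y] (κ : Kernel X Y)
    [IsMarkovKernel κ] (μ : Measure X) [IsFiniteMeasure μ] (y : Y) :
    (ofKernel κ).condProb μ y =ᵐ[μ] fun x => κ x {y} := by
  have hm : Measurable fun x => κ x {y} := κ.measurable_coe (measurableSet_singleton y)
  refine condProb_ae_eq _ hm fun A _ => ?_
  have h : (ofKernel κ).atomValue μ y A = ∫ x in A, (κ x).real {y} ∂μ := by
    rw [atomValue, ofKernel, LinearMap.mk₂_apply, VectorMeasure.integral_toSignedMeasure]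
    congr 1 with x
    rw [← integral_indicator_one (measurableSet_singleton y)]
    rfl
  rw [h, ofReal_integral_eq_lintegral_ofReal]
  · simp
  · refine .of_bound hm.ennreal_toReal.aestronglyMeasurable 1 (ae_of_all _ fun x => ?_)
    simp [abs_of_nonneg]
  · exact ae_of_all _ fun x => measureReal_nonneg

/-! ### Conditional entropy as the minimal expected loss -/

omit [TopologicalSpace Y] in
lemma exists_compProd_eq (p : ProbabilityMeasure (X × Y)) : ∃ (κ : Kernel X Y)
    (_ : IsMarkovKernel κ), (p : Measure (X × Y)).fst.compProd κ = (p : Measure (X × Y)) := by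
  have : Nonempty (X × Y) := (p : Measure (X × Y)).nonempty_of_neZero
  have : Nonempty Y := this.map Prod.snd
  exact ⟨(p : Measure (X × Y)).condKernel, inferInstance, Measure.disintegrate _ _⟩

variable {p : ProbabilityMeasure (X × Y)} {κ : Kernel X Y} [IsMarkovKernel κ]

omit [TopologicalSpace Y] in
lemma posterior_ae_eq (h : (p : Measure (X × Y)).fst.compProd κ = (p : Measure (X × Y))) (y : Y) :
    posterior p y =ᵐ[(p : Measure (X × Y)).fst] fun x => κ x {y} := by
  have hm : Measurable fun x => κ x {y} := κ.measurable_coe (measurableSet_singleton y)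
  have hd : ((p : Measure (X × Y)).restrict (Prod.snd ⁻¹' {y})).fst
      = (p : Measure (X × Y)).fst.withDensity fun x => κ x {y} := by
    ext A hA
    rw [Measure.fst_apply hA, Measure.restrict_apply (measurable_fst hA), withDensity_apply _ hA,
      ← Measure.compProd_apply_prod hA (measurableSet_singleton y), h]
    rfl
  unfold posterior
  rw [hd]
  exact Measure.rnDeriv_withDensity _ hm

omit [TopologicalSpace Y] in
lemma condEntropy_eq_lintegral
    (h : (p : Measure (X × Y)).fst.compProd κ = (p : Measure (X × Y))) :
    condEntropy p = ∫⁻ x, ∑' y, ENNReal.ofReal (Real.negMulLog (κ x {y}).toReal)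
      ∂(p : Measure (X × Y)).fst := by
  refine lintegral_congr_ae ?_
  filter_upwards [ae_all_iff.2 (posterior_ae_eq h)] with x hx
  simp_rw [hx]

variable [DiscreteTopology Y]

lemma crossEntropy_eq_lintegral (β : GeneralizedDecisionRule X Y)
    (h : (p : Measure (X × Y)).fst.compProd κ = (p : Measure (X × Y))) :
    crossEntropy β p = ∫⁻ x, ∑' y, κ x {y} * negLog (β.condProb (p : Measure (X × Y)).fst y x)
      ∂(p : Measure (X × Y)).fst := by
  have hint : ∀ g : X × Y → ℝ≥0∞, Measurable g → ∫⁻ z, g z ∂(p : Measure (X × Y))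
      = ∫⁻ x, ∑' y, κ x {y} * g (x, y) ∂(p : Measure (X × Y)).fst := fun g hg => by
    conv_lhs => rw [← h, Measure.lintegral_compProd hg]
    simp_rw [lintegral_countable', mul_comm]
  exact hint _ (measurable_negLog_condProb β _)

/-- Gibbs' inequality: no generalized decision rule has a smaller expected loss than the
conditional entropy. -/
lemma condEntropy_le_crossEntropy (β : GeneralizedDecisionRule X Y)
    (p : ProbabilityMeasure (X × Y)) : condEntropy p ≤ crossEntropy β p := by
  obtain ⟨κ, _, h⟩ := exists_compProd_eq p
  rw [condEntropy_eq_lintegral h, crossEntropy_eq_lintegral β h]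
  refine lintegral_mono_ae ?_
  filter_upwards [β.tsum_condProb_le_one (p : Measure (X × Y)).fst] with x hx
  have hone : ∑' y, κ x {y} = 1 := by
    simpa using (lintegral_countable' (μ := κ x) 1).symm
  rw [← ENNReal.add_le_add_iff_right ENNReal.one_ne_top]
  calc _ = ∑' y, (ENNReal.ofReal (Real.negMulLog (κ x {y}).toReal) + κ x {y}) := by
        rw [ENNReal.tsum_add, hone]
    _ ≤ ∑' y, (κ x {y} * negLog (β.condProb (p : Measure (X × Y)).fst y x)
          + β.condProb (p : Measure (X × Y)).fst y x) :=
        ENNReal.tsum_le_tsum fun y => ofReal_negMulLog_add_le prob_le_one _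
    _ ≤ _ := by
        rw [ENNReal.tsum_add]
        gcongr

/-- The rule of the posterior distribution attains the bound in Gibbs' inequality. -/
lemma exists_crossEntropy_eq_condEntropy (p : ProbabilityMeasure (X × Y)) :
    ∃ β : GeneralizedDecisionRule X Y, crossEntropy β p = condEntropy p := by
  obtain ⟨κ, _, h⟩ := exists_compProd_eq p
  refine ⟨.ofKernel κ, ?_⟩
  rw [condEntropy_eq_lintegral h, crossEntropy_eq_lintegral _ h]
  refine lintegral_congr_ae ?_
  filter_upwards [ae_all_iff.2 (GeneralizedDecisionRule.condProb_ofKernel κ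
    (p : Measure (X × Y)).fst)] with x hx
  simp_rw [hx, mul_negLog_self (measure_ne_top (κ x) _)]

end Kernel

/-! ### The minimax theorem -/

/-- If every average of the coordinates can be made smaller than `c` on a convex set, then all
coordinates can be made smaller than `c` at once: otherwise a hyperplane separates the set from
the orthant below `c`, and its normal vector is a family of weights that violates the
assumption. -/
lemma exists_forall_lt_of_forall_weights {ι : Type*} [Fintype ι] {S : Set (ι → ℝ)}
    (hS : Convex ℝ S) (hne : S.Nonempty) {c : ℝ}
    (h : ∀ w : ι → ℝ, (∀ i, 0 ≤ w i) → ∑ i, w i = 1 → ∃ t ∈ S, ∑ i, w i * t i < c) :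
    ∃ t ∈ S, ∀ i, t i < c := by
  classical
  by_contra! hcon
  set Q : Set (ι → ℝ) := univ.pi fun _ => Iio c with hQ
  have hQc : Convex ℝ Q := convex_pi fun _ _ => convex_Iio c
  have hQo : IsOpen Q := isOpen_set_pi finite_univ fun _ _ => isOpen_Iio
  have hdisj : Disjoint Q S := disjoint_left.2 fun t htQ htS => by
    obtain ⟨i, hi⟩ := hcon t htS
    exact (not_lt.2 hi) (htQ i (mem_univ i))
  obtain ⟨f, u, hfQ, hfS⟩ := geometric_hahn_banach_open hQc hQo hS hdisj
  set v : ι → ℝ := fun i => f (Pi.single i 1) with hv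
  have hf : ∀ t, f t = ∑ i, v i * t i := fun t => by
    conv_lhs => rw [pi_eq_sum_univ' t]
    simp [hv, mul_comm]
  have hv0 : ∀ i, 0 ≤ v i := by
    intro i
    by_contra! hneg
    -- far enough down the `i`-th axis the functional would exceed `u`
    have hmem : ∀ r : ℝ, 0 ≤ r → f (fun _ => c - 1) - r * v i < u := fun r hr => by
      have := hfQ ((fun _ => c - 1) - r • Pi.single i 1) fun j _ => by
        have : 0 ≤ r * (Pi.single i (1 : ℝ) : ι → ℝ) j :=
          mul_nonneg hr (by rw [Pi.single_apply]; split_ifs <;> simp)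
        simp only [Pi.sub_apply, Pi.smul_apply, smul_eq_mul, mem_Iio]
        linarith
      simpa [hv] using this
    have h0 := hmem 0 le_rfl
    have h1 := hmem ((u - f (fun _ => c - 1)) / (-v i))
      (div_nonneg (by linarith) (by linarith))
    have : (u - f (fun _ => c - 1)) / (-v i) * v i = -(u - f (fun _ => c - 1)) := by
      field_simp [hneg.ne]
    linarith
  obtain ⟨t₀, ht₀⟩ := hne
  have hpos : 0 < ∑ i, v i := by
    refine (Finset.sum_nonneg fun i _ => hv0 i).lt_of_ne' fun hzero => ?_
    have hvz : ∀ i, v i = 0 := fun i =>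
      (Finset.sum_eq_zero_iff_of_nonneg fun i _ => hv0 i).1 hzero i (Finset.mem_univ i)
    have h1 := hfQ (fun _ => c - 1) fun _ _ => by simp
    have h2 := hfS t₀ ht₀
    simp only [hf, hvz, zero_mul, Finset.sum_const_zero] at h1 h2
    linarith
  obtain ⟨t, ht, hlt⟩ := h (fun i => v i / ∑ j, v j) (fun i => div_nonneg (hv0 i) hpos.le)
    (by rw [← Finset.sum_div, div_self hpos.ne'])
  have hlt' : f t < c * ∑ i, v i := by
    rw [hf, ← div_lt_iff₀ hpos, Finset.sum_div]
    simpa only [div_mul_eq_mul_div] using hlt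
  have hle : c * ∑ i, v i ≤ u := by
    -- the corner of the orthant is a limit of points of `Q`
    refine le_of_forall_pos_le_add fun ε hε => ?_
    have := hfQ (fun _ => c - ε / ∑ i, v i) fun _ _ => by
      simpa using div_pos hε hpos
    rw [hf, ← Finset.sum_mul, mul_sub, mul_div_cancel₀ _ hpos.ne'] at this
    linarith
  linarith [hfS t ht]

/-- Finite convex combinations stay in a convex set, over the semifield `ℝ≥0`. -/
lemma sum_mem_of_convex_nnreal {E ι : Type*} [AddCommMonoid E] [Module ℝ≥0 E] {C : Set E}
    (hC : Convex ℝ≥0 C) (s : Finset ι) (w : ι → ℝ≥0) (z : ι → E) (hw : ∑ i ∈ s, w i = 1)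
    (hz : ∀ i ∈ s, z i ∈ C) : ∑ i ∈ s, w i • z i ∈ C := by
  classical
  induction s using Finset.induction_on generalizing w with
  | empty => simp at hw
  | insert a s ha ih =>
    rw [Finset.sum_insert ha] at hw ⊢
    have hza := hz a (Finset.mem_insert_self a s)
    have hzs : ∀ i ∈ s, z i ∈ C := fun i hi => hz i (Finset.mem_insert_of_mem hi)
    rcases eq_or_ne (∑ i ∈ s, w i) 0 with h0 | h0
    · rw [h0, add_zero] at hw
      rw [Finset.sum_eq_zero fun i hi => by
        rw [Finset.sum_eq_zero_iff.1 h0 i hi, zero_smul], hw, one_smul, add_zero]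
      exact hza
    · have hmem := ih (fun i => w i / ∑ j ∈ s, w j) (by rw [← Finset.sum_div, div_self h0]) hzs
      have := hC hza hmem (zero_le) (zero_le) hw
      rw [Finset.smul_sum] at this
      convert this using 3 with i hi
      rw [smul_smul, mul_div_cancel₀ _ h0]

variable {X Y : Type*} [MeasurableSpace X] [Countable Y] [TopologicalSpace Y] [DiscreteTopology Y]
  [MeasurableSpace Y] [DiscreteMeasurableSpace Y]

/-- Against finitely many joint distributions, one rule keeps all expected losses below any
`c` greater than the entropies of their mixtures. -/
lemma exists_forall_crossEntropy_le {ι : Type*} [Fintype ι] [Nonempty ι]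
    (p : ι → ProbabilityMeasure (X × Y)) {v c : ℝ} (hv : 0 ≤ v) (hvc : v < c)
    (h : ∀ w : ι → ℝ≥0, ∑ i, w i = 1 → ∃ r : ProbabilityMeasure (X × Y),
      (r : Measure (X × Y)) = ∑ i, w i • (p i : Measure (X × Y)) ∧
        condEntropy r ≤ ENNReal.ofReal v) :
    ∃ β : GeneralizedDecisionRule X Y, ∀ i, crossEntropy β (p i) ≤ ENNReal.ofReal c := by
  set S : Set (ι → ℝ) := {t | ∃ β : GeneralizedDecisionRule X Y,
    ∀ i, 0 ≤ t i ∧ crossEntropy β (p i) ≤ ENNReal.ofReal (t i)} with hS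
  have hSc : Convex ℝ S := by
    rintro t ⟨β, hβ⟩ t' ⟨γ, hγ⟩ a b ha hb hab
    refine ⟨.mix ha hb hab β γ, fun i => ⟨?_, (crossEntropy_mix_le ha hb hab β γ (p i)).trans ?_⟩⟩
    · exact add_nonneg (mul_nonneg ha (hβ i).1) (mul_nonneg hb (hγ i).1)
    · simp only [Pi.add_apply, Pi.smul_apply, smul_eq_mul]
      rw [ENNReal.ofReal_add (mul_nonneg ha (hβ i).1) (mul_nonneg hb (hγ i).1),
        ENNReal.ofReal_mul ha, ENNReal.ofReal_mul hb]
      gcongr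
      · exact (hβ i).2
      · exact (hγ i).2
  -- The Bayes rule of a mixture with positive weights has finite loss against every component.
  have hpos : ∀ w : ι → ℝ, (∀ i, 0 < w i) → ∑ i, w i = 1 → ∃ t ∈ S, ∑ i, w i * t i ≤ v := by
    intro w hw hw1
    obtain ⟨r, hr, hrv⟩ := h (fun i => (w i).toNNReal) (by
      rw [← Real.toNNReal_sum_of_nonneg fun i _ => (hw i).le, hw1, Real.toNNReal_one])
    obtain ⟨β, hβ⟩ := exists_crossEntropy_eq_condEntropy r
    rw [← hβ, crossEntropy_eq_sum β p _ (fun i => (Real.toNNReal_pos.2 (hw i)).ne') r hr] at hrv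
    have hne : ∀ i, crossEntropy β (p i) ≠ ∞ := fun i htop => by
      have hi := (ENNReal.sum_ne_top.1 (ne_top_of_le_ne_top ENNReal.ofReal_ne_top hrv)) i
        (Finset.mem_univ i)
      rw [htop, ENNReal.mul_top (by simpa using hw i)] at hi
      exact hi rfl
    refine ⟨fun i => (crossEntropy β (p i)).toReal, ⟨β, fun i =>
      ⟨ENNReal.toReal_nonneg, (ENNReal.ofReal_toReal (hne i)).ge⟩⟩, ?_⟩
    have := ENNReal.toReal_le_of_le_ofReal hv hrv
    rw [ENNReal.toReal_sum fun i _ => ENNReal.mul_ne_top ENNReal.coe_ne_top (hne i)] at this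
    simpa [fun i => (hw i).le] using this
  have hcard : (0 : ℝ) < Fintype.card ι := by exact_mod_cast Fintype.card_pos
  have hunif : ∑ _i : ι, (Fintype.card ι : ℝ)⁻¹ = 1 := by simp [hcard.ne']
  have hne : S.Nonempty := by
    obtain ⟨t, ht, -⟩ := hpos (fun _ => (Fintype.card ι : ℝ)⁻¹) (fun _ => by positivity) hunif
    exact ⟨t, ht⟩
  obtain ⟨t, ⟨β, hβ⟩, ht⟩ := exists_forall_lt_of_forall_weights hSc hne (c := c) fun w hw hw1 => by
    -- mixing in the uniform weights makes all weights positive; this `ε` solves `(1 - ε) c > v`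
    have hc : 0 < c := hv.trans_lt hvc
    set ε : ℝ := (c - v) / (2 * c) with hε
    have hε0 : 0 < ε := div_pos (by linarith) (by linarith)
    have hεc : ε * c = (c - v) / 2 := by rw [hε]; field_simp
    have hε1 : 0 < 1 - ε := by
      have : 0 < (1 - ε) * c := by rw [sub_mul, hεc]; linarith
      exact pos_of_mul_pos_left this hc.le
    obtain ⟨t, ht, hle⟩ := hpos (fun i => (1 - ε) * w i + ε * (Fintype.card ι : ℝ)⁻¹)
      (fun i => add_pos_of_nonneg_of_pos (mul_nonneg hε1.le (hw i)) (by positivity))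
      (by rw [Finset.sum_add_distrib, ← Finset.mul_sum, ← Finset.mul_sum, hw1, hunif]; ring)
    refine ⟨t, ht, ?_⟩
    obtain ⟨β, hβ⟩ := ht
    have hle' : (1 - ε) * ∑ i, w i * t i ≤ v := by
      refine le_trans ?_ hle
      rw [Finset.mul_sum]
      refine Finset.sum_le_sum fun i _ => ?_
      have : 0 ≤ ε * (Fintype.card ι : ℝ)⁻¹ * t i := mul_nonneg (by positivity) (hβ i).1
      linarith
    refine lt_of_mul_lt_mul_left (hle'.trans_lt ?_) hε1.le
    rw [sub_mul, hεc]
    linarith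
  exact ⟨β, fun i => (hβ i).2.trans (ENNReal.ofReal_le_ofReal (ht i).le)⟩

end RobustLearning

theorem theorem2 {X Y : Type*} [MeasurableSpace X]
    [Countable Y] [TopologicalSpace Y] [DiscreteTopology Y]
    [MeasurableSpace Y] [DiscreteMeasurableSpace Y]
    (D : Set (ProbabilityMeasure (X × Y))) (hD : D.Nonempty)
    (hconv : Convex ℝ≥0 ((fun p : ProbabilityMeasure (X × Y) => (p : Measure (X × Y))) '' D)) :
    (⨅ β : RobustLearning.GeneralizedDecisionRule X Y,
        ⨆ p ∈ D, RobustLearning.crossEntropy β p) =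
      ⨆ p ∈ D, RobustLearning.condEntropy p := by
  refine le_antisymm ?_ (le_iInf fun β => iSup₂_mono fun p _ =>
    RobustLearning.condEntropy_le_crossEntropy β p)
  refine le_of_forall_gt_imp_ge_of_dense fun c hc => ?_
  rcases eq_or_ne c ∞ with rfl | hc_top
  · exact le_top
  set v : ℝ≥0∞ := ⨆ p ∈ D, RobustLearning.condEntropy p with hv
  have hv_top : v ≠ ∞ := ne_top_of_lt hc
  have hfinite : ∀ u : Finset D, (⋂ p ∈ u, {β : RobustLearning.GeneralizedDecisionRule X Y |
      RobustLearning.crossEntropy β p ≤ c}).Nonempty := by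
    intro u
    rcases u.eq_empty_or_nonempty with rfl | hu
    · obtain ⟨p, -⟩ := hD
      obtain ⟨β, -⟩ := RobustLearning.exists_crossEntropy_eq_condEntropy p
      exact ⟨β, by simp⟩
    · have : Nonempty u := hu.to_subtype
      obtain ⟨β, hβ⟩ := RobustLearning.exists_forall_crossEntropy_le
        (fun i : u => ((i : D) : ProbabilityMeasure (X × Y))) (v := v.toReal) (c := c.toReal)
        ENNReal.toReal_nonneg ((ENNReal.toReal_lt_toReal hv_top hc_top).2 hc) fun w hw => by
          obtain ⟨r, hrD, hr⟩ := RobustLearning.sum_mem_of_convex_nnreal hconv Finset.univ w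
            (fun i : u => (((i : D) : ProbabilityMeasure (X × Y)) : Measure (X × Y))) hw
            fun i _ => mem_image_of_mem _ (i : D).2
          refine ⟨r, hr, ?_⟩
          rw [ENNReal.ofReal_toReal hv_top]
          exact le_iSup₂ (f := fun p (_ : p ∈ D) => RobustLearning.condEntropy p) r hrD
      rw [ENNReal.ofReal_toReal hc_top] at hβ
      exact ⟨β, mem_iInter₂.2 fun p hp => hβ ⟨p, hp⟩⟩
  obtain ⟨β, -, hβ⟩ := isCompact_univ.inter_iInter_nonempty
    (fun p : D => {β : RobustLearning.GeneralizedDecisionRule X Y |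
      RobustLearning.crossEntropy β p ≤ c})
    (fun p => (RobustLearning.lowerSemicontinuous_crossEntropy (p : ProbabilityMeasure
      (X × Y))).isClosed_preimage c)
    (fun u => by simpa only [univ_inter] using hfinite u)
  exact (iInf_le _ β).trans (iSup₂_le fun p hp => mem_iInter.1 hβ ⟨p, hp⟩)
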